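/- Let $\mathcal H^{\mathrm{dif}}=\mathbb C\langle a_1,a_2,\dots\rangle$ be the free associative unital algebra, put $a_0=1$ and $A(x)=\sum_{n\ge 0}a_nx^{n+1}$. It is a Hopf algebra whose co-product $\Delta^{\mathrm{dif}}$ is the algebra homomorphism determined by $$\Delta^{\mathrm{dif}}A(x)=\langle z^{-1}\rangle\, A(z)\otimes\frac1{z-A(x)},$$ where $\frac1{z-A(x)}=\sum_{j\ge0}A(x)^jz^{-j-1}$ and $\langle z^{-1}\rangle$ takes the coefficient of $z^{-1}$, and whose co-unit is the algebra homomorphism with $\varepsilon(a_n)=0$ for $n\ge1$. Let $Y_\infty$ be the set of rooted planar binary trees, $|t|$ the number of internal vertices of $t$, $\|$ the tree without internal vertices, $r\vee s$ the grafting of $r$ (left) and $s$ (right) on a new root, and $V(t)=\|\vee t$. Let $\widetilde{\mathcal H}^\alpha=\mathbb C Y_\infty$ be the vector space spanned by all trees, with the over product $t/s$ (graft the root of $t$ on the left-most leaf of $s$) and unit $\|$. It is a Hopf algebra whose co-product $\Delta^\alpha$ and right co-action $\delta^\alpha$ on itself are the linear maps defined simultaneously by $$\Delta^\alpha\|=\delta^\alpha\|=\|\otimes\|,\qquad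 \delta^\alpha V(r)=(V\otimes\mathrm{Id})\delta^\alpha(r),\qquad \Delta^\alpha V(r)=\|\otimes V(r)+\delta^\alpha V(r),$$ $$\Delta^\alpha(r\vee s)=\Delta^\alpha(r)/\Delta^\alpha V(s),\qquad \delta^\alpha(r\vee s)=\Delta^\alpha(r)/\delta^\alpha V(s),$$ and whose co-unit sends $\|$ to $1$ and every other tree to $0$. For $n\ge0$ let $t_n=\sum_{|t|=n}t$ (so $t_0=\|$), and let $\Omega:\mathcal H^{\mathrm{dif}}\to\widetilde{\mathcal H}^\alpha$ be the homomorphism of unital algebras with $\Omega(a_n)=t_n$ for all $n\ge 1$. **Theorem.** $\Omega$ is injective and is a homomorphism of co-algebras, i.e. $\Delta^\alpha\circ\Omega=(\Omega\otimes\Omega)\circ\Delta^{\mathrm{dif}}$ and $\varepsilon\circ\Omega=\varepsilon$. Hence $\mathcal H^{\mathrm{dif}}$ is a Hopf sub-algebra of $\widetilde{\mathcal H}^\alpha$: $\Omega$ commutes with the antipodes, and its image is a subalgebra $B$ with $\Delta^\alpha(B)\subseteq B\otimes B$ that is stable under the antipode. Moreover, for all $n\ge0$, $$\delta^\alpha(t_n)=\sum_{k=0}^n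 t_k\otimes Q^{(k-1)}_{n-k}(t),$$ where, for $m,n\ge0$, $Q^{(n)}_m(t)=\sum_{j_0+\dots+j_n=m,\ j_i\ge0}t_{j_0}/t_{j_1}/\cdots/t_{j_n}$, and $Q^{(-1)}_0(t)=1$, $Q^{(-1)}_m(t)=0$ for $m>0$. -/

import Mathlib

open scoped TensorProduct

noncomputable section

namespace NCDiff

/-! ### Generalities -/

/-- For a sequence `c` in a (not necessarily commutative) algebra, with `c 0` playing the role of
the unit, `Qpoly c N m` is the sum of all ordered products `c j₁ * ⋯ * c j_N` of `N` factors with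
`j₁ + ⋯ + j_N = m`. In terms of the polynomials `Q_m^{(n)}` (sums over `j₀ + ⋯ + j_n = m` of
products of `n + 1` factors) the upper index is shifted by one:
`Qpoly c (n + 1) m = Q_m^{(n)}(c)`, and `Qpoly c 0 m = Q_m^{(-1)}(c)`, the empty product if `m = 0`
and `0` if `m > 0`. -/
def Qpoly {R : Type*} [Semiring R] (c : ℕ → R) (N m : ℕ) : R :=
  ∑ j ∈ Finset.Nat.antidiagonalTuple N m, (List.ofFn fun i => c (j i)).prod

/-- A subalgebra of a Hopf algebra is a Hopf subalgebra if the co-product maps it into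
`B ⊗ B` and the antipode maps it into itself. -/
def IsHopfSubalgebra {H : Type*} [Ring H] [HopfAlgebra ℂ H] (B : Subalgebra ℂ H) : Prop :=
  (∀ x ∈ B, Coalgebra.comul (R := ℂ) x ∈
      LinearMap.range (TensorProduct.map B.val.toLinearMap B.val.toLinearMap)) ∧
    ∀ x ∈ B, HopfAlgebra.antipode ℂ x ∈ B

section Antihom

variable {H : Type*} [Ring H] [Algebra ℂ H]

/-- An algebra map to the opposite algebra, as a linear endomorphism. -/
def unopLin (S : H →ₐ[ℂ] Hᵐᵒᵖ) : H →ₗ[ℂ] H :=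
  (MulOpposite.opLinearEquiv ℂ).symm.toLinearMap ∘ₗ S.toLinearMap

theorem unopLin_one (S : H →ₐ[ℂ] Hᵐᵒᵖ) : unopLin S 1 = 1 := by simp [unopLin]

theorem unopLin_mul (S : H →ₐ[ℂ] Hᵐᵒᵖ) (x y : H) :
    unopLin S (x * y) = unopLin S y * unopLin S x := by simp [unopLin]

theorem left_key (S : H →ₐ[ℂ] Hᵐᵒᵖ) (w : H ⊗[ℂ] H) (v₁ v₂ : H) :
    LinearMap.mul' ℂ H ((unopLin S).rTensor H (w * (v₁ ⊗ₜ v₂))) =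
      unopLin S v₁ * LinearMap.mul' ℂ H ((unopLin S).rTensor H w) * v₂ := by
  induction w with
  | zero => simp
  | add w₁ w₂ h₁ h₂ => simp only [add_mul, mul_add, map_add, h₁, h₂]
  | tmul w₁ w₂ => simp [unopLin_mul, mul_assoc]

theorem left_gen (S : H →ₐ[ℂ] Hᵐᵒᵖ) (w v : H ⊗[ℂ] H) :
    LinearMap.mul' ℂ H ((unopLin S).rTensor H (w * v)) =
      LinearMap.mul' ℂ H ((unopLin S).rTensor H
        ((1 ⊗ₜ LinearMap.mul' ℂ H ((unopLin S).rTensor H w)) * v)) := by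
  induction v with
  | zero => simp
  | add v₁ v₂ h₁ h₂ => simp only [mul_add, map_add, h₁, h₂]
  | tmul v₁ v₂ => rw [left_key]; simp [mul_assoc]

theorem left_aux (S : H →ₐ[ℂ] Hᵐᵒᵖ) (w v : H ⊗[ℂ] H) (c : ℂ)
    (h : LinearMap.mul' ℂ H ((unopLin S).rTensor H w) = algebraMap ℂ H c) :
    LinearMap.mul' ℂ H ((unopLin S).rTensor H (w * v)) =
      algebraMap ℂ H c * LinearMap.mul' ℂ H ((unopLin S).rTensor H v) := by
  induction v with
  | zero => simp
  | add v₁ v₂ h₁ h₂ => simp only [mul_add, map_add, h₁, h₂]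
  | tmul v₁ v₂ =>
    rw [left_key, h, ← Algebra.commutes c (unopLin S v₁)]
    simp [mul_assoc]

theorem right_aux (S : H →ₐ[ℂ] Hᵐᵒᵖ) (w v : H ⊗[ℂ] H) (c : ℂ)
    (h : LinearMap.mul' ℂ H ((unopLin S).lTensor H v) = algebraMap ℂ H c) :
    LinearMap.mul' ℂ H ((unopLin S).lTensor H (w * v)) =
      algebraMap ℂ H c * LinearMap.mul' ℂ H ((unopLin S).lTensor H w) := by
  induction w with
  | zero => simp
  | add v₁ v₂ h₁ h₂ => simp only [add_mul, mul_add, map_add, h₁, h₂]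
  | tmul w₁ w₂ =>
    have key : ∀ v : H ⊗[ℂ] H,
        LinearMap.mul' ℂ H ((unopLin S).lTensor H ((w₁ ⊗ₜ w₂) * v)) =
          w₁ * LinearMap.mul' ℂ H ((unopLin S).lTensor H v) * unopLin S w₂ := by
      intro v
      induction v with
      | zero => simp
      | add w₁ w₂ h₁ h₂ => simp only [add_mul, mul_add, map_add, h₁, h₂]
      | tmul v₁ v₂ => simp [unopLin_mul, mul_assoc]
    rw [key, h, ← Algebra.commutes c w₁]
    simp [mul_assoc]

end Antihom

/-! ### The Hopf algebra of formal diffeomorphisms -/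

/-- The free associative unital algebra `ℂ⟨a₁, a₂, …⟩`; the `n`-th free generator is `a_{n+1}`. -/
def Hdif : Type := FreeAlgebra ℂ ℕ

namespace Hdif

instance instRing : Ring Hdif := inferInstanceAs (Ring (FreeAlgebra ℂ ℕ))
instance instAlgebra : Algebra ℂ Hdif := inferInstanceAs (Algebra ℂ (FreeAlgebra ℂ ℕ))

/-- The generators `a_n`, with the convention `a₀ = 1`. -/
def a : ℕ → Hdif
  | 0 => 1
  | n + 1 => FreeAlgebra.ι ℂ n

/-- The unital algebra map out of `Hdif` with `a_{n+1} ↦ f n`. -/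
def lift {B : Type*} [Ring B] [Algebra ℂ B] (f : ℕ → B) : Hdif →ₐ[ℂ] B := FreeAlgebra.lift ℂ f

theorem lift_a {B : Type*} [Ring B] [Algebra ℂ B] (f : ℕ → B) (n : ℕ) :
    lift f (a (n + 1)) = f n := FreeAlgebra.lift_ι_apply f n

theorem hom_ext {B : Type*} [Ring B] [Algebra ℂ B] {f g : Hdif →ₐ[ℂ] B}
    (h : ∀ n, f (a (n + 1)) = g (a (n + 1))) : f = g :=
  FreeAlgebra.hom_ext (funext h)

theorem induction {P : Hdif → Prop} (h0 : ∀ c : ℂ, P (algebraMap ℂ Hdif c))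
    (h1 : ∀ n, P (a (n + 1))) (hm : ∀ x y, P x → P y → P (x * y))
    (ha : ∀ x y, P x → P y → P (x + y)) (x : Hdif) : P x :=
  FreeAlgebra.induction ℂ ℕ h0 h1 hm ha x

/-- The generating series `A(x) = x + ∑_{n ≥ 1} a_n x^{n+1} = ∑_{n ≥ 0} a_n x^{n+1}`. -/
def A : PowerSeries Hdif := PowerSeries.mk fun
  | 0 => 0
  | n + 1 => a n

/-- The coefficient of `x^m` in `A(x)^j`. -/
def c (j m : ℕ) : Hdif := PowerSeries.coeff m (A ^ j)

/-- The coefficient of `x^m` in the residue `⟨z⁻¹⟩ A(z) ⊗ 1/(z - A(x))`. Expanding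
`1/(z - A(x)) = ∑_j A(x)^j z^{-j-1}`, the residue in `z` is `∑_j [z^j]A(z) ⊗ A(x)^j`; the terms with
`j > m` do not contribute to the coefficient of `x^m`, since `A(x)` has no constant term. -/
def residueCoeff (m : ℕ) : Hdif ⊗[ℂ] Hdif :=
  ∑ j ∈ Finset.range (m + 1), PowerSeries.coeff j A ⊗ₜ[ℂ] PowerSeries.coeff m (A ^ j)

/-- The co-product: the algebra map with `Δ A(x) = ⟨z⁻¹⟩ A(z) ⊗ 1/(z - A(x))`, so that `Δ a_n` is
the coefficient of `x^{n+1}` on the right-hand side. -/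
def Δ : Hdif →ₐ[ℂ] Hdif ⊗[ℂ] Hdif := lift fun n => residueCoeff (n + 2)

/-- The co-unit: the algebra map with `ε a_n = 0` for `n ≥ 1`. -/
def ε : Hdif →ₐ[ℂ] ℂ := lift fun _ => 0

theorem c_add (i j m : ℕ) : c (i + j) m =
    ∑ p ∈ Finset.HasAntidiagonal.antidiagonal m, c i p.1 * c j p.2 := by
  simp [c, pow_add, PowerSeries.coeff_mul]

theorem c_zero (m : ℕ) : c 0 m = if m = 0 then 1 else 0 := by
  simp [c, PowerSeries.coeff_one]

theorem c_one_zero : c 1 0 = 0 := by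
  simp only [c, pow_one, A, PowerSeries.coeff_mk]

theorem c_one_succ (n : ℕ) : c 1 (n + 1) = a n := by
  simp only [c, pow_one, A, PowerSeries.coeff_mk]

theorem c_lt {j : ℕ} : ∀ {m : ℕ}, m < j → c j m = 0 := by
  induction j with
  | zero => intro m h; omega
  | succ j ih =>
    intro m h
    rw [c_add]
    refine Finset.sum_eq_zero fun p hp => ?_
    rw [Finset.HasAntidiagonal.mem_antidiagonal] at hp
    by_cases h1 : p.1 < j
    · rw [ih h1, zero_mul]
    · have : p.2 = 0 := by omega
      rw [this, c_one_zero, mul_zero]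

theorem c_self (j : ℕ) : c j j = 1 := by
  induction j with
  | zero => simp [c_zero]
  | succ j ih =>
    rw [c_add, Finset.sum_eq_single (j, 1)]
    · rw [ih, show (1 : ℕ) = 0 + 1 from rfl, c_one_succ]; simp [a]
    · intro p hp hne
      rw [Finset.HasAntidiagonal.mem_antidiagonal] at hp
      by_cases h1 : p.1 < j
      · rw [c_lt h1, zero_mul]
      · have : p.2 = 0 := by
          by_contra h2
          exact hne (Prod.ext (by simp; omega) (by simp; omega))
        rw [this, c_one_zero, mul_zero]
    · intro h; simp at h

theorem Δ_c_one (m N : ℕ) (h : m < N) :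
    Δ (c 1 m) = ∑ i ∈ Finset.range N, c 1 i ⊗ₜ[ℂ] c i m := by
  have h1 : ∑ i ∈ Finset.range N, c 1 i ⊗ₜ[ℂ] c i m = residueCoeff m := by
    symm
    unfold residueCoeff
    refine (Finset.sum_congr rfl fun j _ => by simp only [c, pow_one]).trans
      (Finset.sum_subset (f := fun i => c 1 i ⊗ₜ[ℂ] c i m) (s₁ := Finset.range (m + 1)) ?_ ?_)
    · intro x hx; simp at hx ⊢; omega
    · intro x _ hx
      simp at hx
      rw [c_lt (show m < x by omega), TensorProduct.tmul_zero]
  rw [h1]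
  match m with
  | 0 =>
    rw [c_one_zero, map_zero]
    have := c_one_zero
    simp only [c, pow_one] at this
    simp [residueCoeff, this]
  | 1 =>
    have h2 : c 1 1 = 1 := c_self 1
    have h0 := c_one_zero
    rw [h2, map_one]
    simp only [c, pow_one] at h2 h0
    simp [residueCoeff, Finset.sum_range_succ, h2, h0, Algebra.TensorProduct.one_def]
  | n + 2 => rw [c_one_succ, Δ, lift_a]

theorem Δ_c (j : ℕ) : ∀ m N : ℕ, m < N →
    Δ (c j m) = ∑ i ∈ Finset.range N, c j i ⊗ₜ[ℂ] c i m := by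
  induction j with
  | zero =>
    intro m N h
    rw [Finset.sum_eq_single 0]
    · simp only [c_zero]
      split_ifs <;> simp [Algebra.TensorProduct.one_def]
    · intro i _ hi; simp [c_zero, hi]
    · intro h0; simp at h0; omega
  | succ j ih =>
    intro m N h
    have e1 : Δ (c (j + 1) m) = ∑ x ∈ Finset.range N ×ˢ Finset.range N,
        (c j x.1 * c 1 x.2) ⊗ₜ[ℂ] c (x.1 + x.2) m := by
      rw [c_add, map_sum]
      have : ∀ p ∈ Finset.HasAntidiagonal.antidiagonal m, Δ (c j p.1 * c 1 p.2) =
          ∑ x ∈ Finset.range N ×ˢ Finset.range N,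
            (c j x.1 * c 1 x.2) ⊗ₜ[ℂ] (c x.1 p.1 * c x.2 p.2) := by
        intro p hp
        rw [Finset.HasAntidiagonal.mem_antidiagonal] at hp
        rw [map_mul, ih p.1 N (by omega), Δ_c_one p.2 N (by omega), Finset.sum_mul_sum,
          Finset.sum_product]
        simp
      rw [Finset.sum_congr rfl this, Finset.sum_comm]
      refine Finset.sum_congr rfl fun x _ => ?_
      rw [c_add, TensorProduct.tmul_sum]
    have e2 : ∑ x ∈ Finset.range N ×ˢ Finset.range N,
        (c j x.1 * c 1 x.2) ⊗ₜ[ℂ] c (x.1 + x.2) m =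
        ∑ x ∈ (Finset.range N ×ˢ Finset.range N).filter (fun x => x.1 + x.2 ∈ Finset.range N),
        (c j x.1 * c 1 x.2) ⊗ₜ[ℂ] c (x.1 + x.2) m := by
      symm
      refine Finset.sum_subset (Finset.filter_subset _ _) ?_
      intro x hx hx'
      have : m < x.1 + x.2 := by
        simp at hx hx'; have := hx' hx.1 hx.2; omega
      rw [c_lt this, TensorProduct.tmul_zero]
    rw [e1, e2, ← Finset.sum_fiberwise_of_maps_to (t := Finset.range N) (g := fun x : ℕ × ℕ => x.1 + x.2)
      (fun x hx => (Finset.mem_filter.1 hx).2)]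
    refine Finset.sum_congr rfl fun s hs => ?_
    rw [c_add, TensorProduct.sum_tmul]
    have : Finset.filter (fun x : ℕ × ℕ => x.1 + x.2 = s)
        ((Finset.range N ×ˢ Finset.range N).filter (fun x => x.1 + x.2 ∈ Finset.range N)) =
        Finset.HasAntidiagonal.antidiagonal s := by
      ext x
      simp at hs ⊢
      omega
    rw [this]
    refine Finset.sum_congr rfl fun x hx => ?_
    rw [Finset.HasAntidiagonal.mem_antidiagonal.1 hx]

theorem ε_c_one (m : ℕ) : ε (c 1 m) = if m = 1 then 1 else 0 := by
  match m with
  | 0 => simp [c_one_zero]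
  | 1 => rw [c_self]; simp
  | n + 2 => rw [c_one_succ, ε, lift_a]; simp

theorem ε_c (j : ℕ) : ∀ m, ε (c j m) = if m = j then 1 else 0 := by
  induction j with
  | zero => intro m; rw [c_zero]; split_ifs <;> simp
  | succ j ih =>
    intro m
    rw [c_add, map_sum]
    simp only [map_mul, ih, ε_c_one]
    by_cases h : m = j + 1
    · rw [if_pos h, Finset.sum_eq_single (j, 1)]
      · simp
      · rintro ⟨p, q⟩ hp hne
        by_cases h1 : p = j
        · have : q ≠ 1 := fun h2 => hne (by rw [h1, h2])
          simp [this]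
        · simp [h1]
      · intro hh; simp at hh; omega
    · rw [if_neg h]
      refine Finset.sum_eq_zero ?_
      rintro ⟨p, q⟩ hp
      rw [Finset.HasAntidiagonal.mem_antidiagonal] at hp
      simp at hp
      by_cases h1 : p = j
      · have : q ≠ 1 := fun h2 => h (by omega)
        simp [this]
      · simp [h1]

instance instBialgebra : Bialgebra ℂ Hdif :=
  Bialgebra.ofAlgHom Δ ε
    (by
      refine hom_ext fun n => ?_
      have h := Δ_c 1 (n + 2) (n + 3) (by omega)
      rw [c_one_succ] at h
      simp only [AlgHom.comp_apply, h, map_sum, Algebra.TensorProduct.map_tmul]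
      have l : ∀ x ∈ Finset.range (n + 3),
          (Algebra.TensorProduct.assoc ℂ ℂ ℂ Hdif Hdif Hdif).toAlgHom
            (Δ (c 1 x) ⊗ₜ[ℂ] (AlgHom.id ℂ Hdif) (c x (n + 2))) =
          ∑ i ∈ Finset.range (n + 3), c 1 i ⊗ₜ[ℂ] (c i x ⊗ₜ[ℂ] c x (n + 2)) := by
        intro x hx
        rw [Δ_c 1 x (n + 3) (by simpa using hx), TensorProduct.sum_tmul, map_sum]
        rfl
      have r : ∀ x ∈ Finset.range (n + 3),
          (AlgHom.id ℂ Hdif) (c 1 x) ⊗ₜ[ℂ] Δ (c x (n + 2)) =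
          ∑ i ∈ Finset.range (n + 3), c 1 x ⊗ₜ[ℂ] (c x i ⊗ₜ[ℂ] c i (n + 2)) := by
        intro x _
        rw [Δ_c x (n + 2) (n + 3) (by omega), TensorProduct.tmul_sum]
        rfl
      rw [Finset.sum_congr rfl l, Finset.sum_congr rfl r, Finset.sum_comm])
    (by
      refine hom_ext fun n => ?_
      have h := Δ_c 1 (n + 2) (n + 3) (by omega)
      rw [c_one_succ] at h
      simp only [AlgHom.comp_apply, h, map_sum, Algebra.TensorProduct.map_tmul, ε_c]
      rw [Finset.sum_eq_single 1]
      · simp [c_one_succ]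
      · intro b _ hb; simp [hb]
      · intro hh; simp at hh)
    (by
      refine hom_ext fun n => ?_
      have h := Δ_c 1 (n + 2) (n + 3) (by omega)
      rw [c_one_succ] at h
      simp only [AlgHom.comp_apply, h, map_sum, Algebra.TensorProduct.map_tmul, ε_c]
      rw [Finset.sum_eq_single (n + 2)]
      · simp [c_one_succ]
      · intro b _ hb; simp [hb.symm]
      · intro hh; simp at hh)

/-- The antipode on generators: `S a₀ = 1` and `S a_n = - ∑_{k < n} (S a_k) Q^{(k)}_{n-k}(a)`. -/
def Sgen : ℕ → Hdif
  | 0 => 1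
  | n + 1 => -∑ k : Fin (n + 1), Sgen k * c (k + 1) (n + 2)

/-- The antipode as an algebra map to the opposite algebra. -/
def Sop : Hdif →ₐ[ℂ] Hdifᵐᵒᵖ := lift fun n => MulOpposite.op (Sgen (n + 1))

/-- The antipode. -/
def S : Hdif →ₗ[ℂ] Hdif := unopLin Sop

theorem S_a (n : ℕ) : S (a n) = Sgen n := by
  match n with
  | 0 => rw [Sgen]; exact unopLin_one _
  | n + 1 => simp [S, unopLin, Sop, lift_a]

theorem left_antipode (x : Hdif) :
    LinearMap.mul' ℂ Hdif (S.rTensor Hdif (Δ x)) = algebraMap ℂ Hdif (ε x) := by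
  induction x using induction with
  | h0 r => simp [Algebra.TensorProduct.one_def, Algebra.algebraMap_eq_smul_one, S, unopLin_one]
  | h1 n =>
    have h := Δ_c 1 (n + 2) (n + 3) (by omega)
    rw [c_one_succ] at h
    have e : ε (a (n + 1)) = 0 := lift_a _ _
    rw [h, e, map_zero, map_sum, map_sum, Finset.sum_range_succ', Finset.sum_range_succ]
    simp only [LinearMap.rTensor_tmul, LinearMap.mul'_apply, c_one_succ, S_a, c_one_zero, map_zero,
      zero_mul, add_zero, c_self, mul_one]
    rw [Sgen, ← Fin.sum_univ_eq_sum_range (fun k => Sgen k * c (k + 1) (n + 2))]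
    exact add_neg_cancel _
  | hm x y hx hy => rw [map_mul, S, left_aux _ _ _ _ hx, ← S, hy, map_mul, map_mul]
  | ha x y hx hy => simp only [map_add, hx, hy]

theorem right_antipode (x : Hdif) :
    LinearMap.mul' ℂ Hdif (S.lTensor Hdif (Δ x)) = algebraMap ℂ Hdif (ε x) := by
  have left : ∀ i m N, m < N → ∑ k ∈ Finset.range N, S (c i k) * c k m =
      if m = i then 1 else 0 := by
    intro i m N h
    have := left_antipode (c i m)
    rw [Δ_c i m N h, ε_c] at this
    simp only [map_sum, LinearMap.rTensor_tmul, LinearMap.mul'_apply] at this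
    rw [this]; split_ifs <;> simp
  have right : ∀ i m N, m < N → ∑ k ∈ Finset.range N, c i k * S (c k m) =
      if m = i then 1 else 0 := by
    intro i m
    induction m using Nat.strong_induction_on with
    | _ m ih =>
      intro N h
      have e : ∑ l ∈ Finset.range (m + 1),
          (∑ k ∈ Finset.range N, c i k * S (c k l)) * c l m = c i m := by
        simp only [Finset.sum_mul, mul_assoc]
        rw [Finset.sum_comm]
        simp only [← Finset.mul_sum]
        rw [Finset.sum_congr rfl fun k _ => by rw [left k m (m + 1) (by omega)]]
        rw [Finset.sum_eq_single m]
        · simp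
        · intro b _ hb; simp [hb.symm]
        · intro hh; simp at hh; omega
      rw [Finset.sum_range_succ, c_self, mul_one] at e
      rw [Finset.sum_congr rfl fun l hl => by
        rw [ih l (by simpa using hl) N (by simp at hl; omega)]] at e
      by_cases hm : m = i
      · subst hm
        rw [Finset.sum_eq_zero, zero_add, c_self] at e
        · rw [e]; simp
        · intro l hl
          simp at hl
          simp [hl.ne]
      · rw [if_neg hm]
        by_cases hi : i < m
        · rw [Finset.sum_eq_single i] at e
          · simpa using e
          · intro b _ hb; simp [hb]
          · intro hh; simp at hh; omega
        · rw [Finset.sum_eq_zero, zero_add] at e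
          · rw [e, c_lt (by omega)]
          · intro l hl
            simp at hl
            rw [if_neg (by omega), zero_mul]
  induction x using induction with
  | h0 r => simp [Algebra.TensorProduct.one_def, Algebra.algebraMap_eq_smul_one, S, unopLin_one]
  | h1 n =>
    have h := Δ_c 1 (n + 2) (n + 3) (by omega)
    have e := right 1 (n + 2) (n + 3) (by omega)
    have e' := ε_c 1 (n + 2)
    rw [← c_one_succ, h, e']
    simp only [map_sum, LinearMap.lTensor_tmul, LinearMap.mul'_apply]
    rw [e]
    split_ifs <;> simp
  | hm x y hx hy =>
    rw [map_mul, S, right_aux _ _ _ _ hy, ← S, hx, map_mul ε, mul_comm (ε x),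
      map_mul]
  | ha x y hx hy => simp only [map_add, hx, hy]

instance instHopfAlgebra : HopfAlgebra ℂ Hdif where
  antipode := S
  mul_antipode_rTensor_comul := LinearMap.ext left_antipode
  mul_antipode_lTensor_comul := LinearMap.ext right_antipode

end Hdif

/-! ### The Hopf algebra on planar binary trees -/

/-- Rooted planar binary trees: `BinaryTree.nil` is the root tree `|` without internal vertices and
`BinaryTree.node () r s` is the grafting `r ∨ s` of `r` (left) and `s` (right) on a new root. -/
abbrev PBT : Type := BinaryTree Unit

namespace PBT

/-- The tree `t` over `s`: the root of `t` is grafted on the left-most leaf of `s`. -/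
def graftOver (t : PBT) : PBT → PBT
  | .nil => t
  | .node _ r s => .node () (graftOver t r) s

theorem nil_graftOver (s : PBT) : graftOver .nil s = s := by
  induction s with
  | nil => rfl
  | node _ r s hr _ => simp only [graftOver, hr]

theorem graftOver_assoc (t s u : PBT) : graftOver (graftOver t s) u = graftOver t (graftOver s u) := by
  induction u with
  | nil => rfl
  | node _ r v hr _ => simp only [graftOver, hr]

/-- The monoid of trees under the over product, with unit the root tree. -/
instance instMonoid : Monoid PBT where
  mul := graftOver
  one := .nil
  mul_assoc := graftOver_assoc
  one_mul := nil_graftOver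
  mul_one _ := rfl

theorem one_def : (1 : PBT) = .nil := rfl

theorem mul_node (t r s : PBT) : t * .node () r s = .node () (t * r) s := rfl

end PBT

/-- The vector space spanned by all planar binary trees, with the over product extended
bilinearly. -/
def Htree : Type := MonoidAlgebra ℂ PBT

namespace Htree

instance instRing : Ring Htree := inferInstanceAs (Ring (MonoidAlgebra ℂ PBT))
instance instAlgebra : Algebra ℂ Htree := inferInstanceAs (Algebra ℂ (MonoidAlgebra ℂ PBT))

/-- The basis element of a tree, as a monoid homomorphism. -/
def tree : PBT →* Htree := MonoidAlgebra.of ℂ PBT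

/-- Linear extension of a map defined on trees. -/
def linExt {M : Type*} [AddCommGroup M] [Module ℂ M] (f : PBT → M) : Htree →ₗ[ℂ] M :=
  Finsupp.linearCombination ℂ f ∘ₗ (MonoidAlgebra.coeffLinearEquiv ℂ).toLinearMap

theorem linExt_tree {M : Type*} [AddCommGroup M] [Module ℂ M] (f : PBT → M) (t : PBT) :
    linExt f (tree t) = f t := by
  show Finsupp.linearCombination ℂ f (Finsupp.single t 1) = f t
  simp

theorem lin_ext {M : Type*} [AddCommGroup M] [Module ℂ M] {f g : Htree →ₗ[ℂ] M}
    (h : ∀ t, f (tree t) = g (tree t)) : f = g :=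
  MonoidAlgebra.lhom_ext' fun t => LinearMap.ext_ring (h t)

theorem hom_ext {B : Type*} [Ring B] [Algebra ℂ B] {f g : Htree →ₐ[ℂ] B}
    (h : ∀ t, f (tree t) = g (tree t)) : f = g :=
  AlgHom.toLinearMap_injective (lin_ext h)

/-- The algebra map extending a multiplicative map on trees. -/
def lift {B : Type*} [Ring B] [Algebra ℂ B] (f : PBT →* B) : Htree →ₐ[ℂ] B :=
  MonoidAlgebra.lift ℂ B PBT f

theorem lift_tree {B : Type*} [Ring B] [Algebra ℂ B] (f : PBT →* B) (t : PBT) :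
    lift f (tree t) = f t := MonoidAlgebra.lift_of f t

/-- The linear map `V`, with `V(t) = | ∨ t` on trees. -/
def V : Htree →ₗ[ℂ] Htree := linExt fun t => tree (.node () .nil t)

theorem V_tree (t : PBT) : V (tree t) = tree (.node () .nil t) := linExt_tree _ t

/-- The values on a tree of the co-product `Δ` (first component) and of the co-action `δ`
(second component), defined by simultaneous recursion:
`Δ | = δ | = | ⊗ |`, `Δ (r ∨ s) = Δ r / Δ V(s)`, `δ (r ∨ s) = Δ r / δ V(s)`, where
`δ V(s) = (V ⊗ Id) δ s` and `Δ V(s) = | ⊗ V(s) + δ V(s)`. -/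
def coprods : PBT → (Htree ⊗[ℂ] Htree) × (Htree ⊗[ℂ] Htree)
  | .nil => (1 ⊗ₜ 1, 1 ⊗ₜ 1)
  | .node _ r s =>
    ((coprods r).1 * (1 ⊗ₜ V (tree s) + V.rTensor Htree (coprods s).2),
      (coprods r).1 * V.rTensor Htree (coprods s).2)

theorem coprods_mul (t s : PBT) : (coprods (t * s)).1 = (coprods t).1 * (coprods s).1 := by
  induction s with
  | nil =>
    rw [← PBT.one_def, mul_one, PBT.one_def, coprods, ← Algebra.TensorProduct.one_def, mul_one]
  | node _ r u hr _ => rw [PBT.mul_node]; simp only [coprods, hr, mul_assoc]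

/-- The co-product `Δ^α`. -/
def Δ : Htree →ₐ[ℂ] Htree ⊗[ℂ] Htree := lift
  { toFun := fun t => (coprods t).1
    map_one' := rfl
    map_mul' := coprods_mul }

/-- The right co-action `δ^α`. -/
def δ : Htree →ₗ[ℂ] Htree ⊗[ℂ] Htree := linExt fun t => (coprods t).2

/-- The co-unit: `1` on the root tree and `0` on all other trees. -/
def ε : Htree →ₐ[ℂ] ℂ := lift
  { toFun := fun t => match t with
      | .nil => 1
      | .node _ _ _ => 0
    map_one' := rfl
    map_mul' := by
      intro t s
      cases s with
      | nil => rw [← PBT.one_def, mul_one]; exact (mul_one _).symm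
      | node _ r u => rw [PBT.mul_node]; exact (mul_zero _).symm }

theorem Δ_tree (t : PBT) : Δ (tree t) = (coprods t).1 := lift_tree _ t

theorem δ_tree (t : PBT) : δ (tree t) = (coprods t).2 := linExt_tree _ t

theorem ε_nil : ε (tree .nil) = 1 := lift_tree _ _

theorem ε_node (r s : PBT) : ε (tree (.node () r s)) = 0 := lift_tree _ _

/-! The defining recursive formulae. -/

theorem Δ_nil : Δ (tree .nil) = tree .nil ⊗ₜ tree .nil := Δ_tree _

theorem δ_nil : δ (tree .nil) = tree .nil ⊗ₜ tree .nil := δ_tree _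

theorem δ_V (r : PBT) : δ (V (tree r)) = V.rTensor Htree (δ (tree r)) := by
  rw [V_tree, δ_tree, δ_tree, coprods, coprods, ← Algebra.TensorProduct.one_def]
  exact one_mul _

theorem Δ_V (r : PBT) : Δ (V (tree r)) = tree .nil ⊗ₜ V (tree r) + δ (V (tree r)) := by
  rw [δ_V, V_tree, Δ_tree, δ_tree, coprods, coprods, ← Algebra.TensorProduct.one_def, one_mul,
    V_tree]
  rfl

theorem δ_node (r s : PBT) :
    δ (tree (.node () r s)) = Δ (tree r) * δ (V (tree s)) := by
  rw [δ_V, δ_tree, δ_tree, Δ_tree, coprods]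

theorem tree_node (r s : PBT) : tree (.node () r s) = tree r * V (tree s) := by
  rw [V_tree, ← map_mul, PBT.mul_node, ← PBT.one_def, mul_one]

theorem Δ_node (r s : PBT) :
    Δ (tree (.node () r s)) = Δ (tree r) * Δ (V (tree s)) := by
  rw [tree_node, map_mul]

theorem tree_nil : tree .nil = 1 := map_one tree

theorem δ_one : δ 1 = 1 := by rw [← tree_nil, δ_nil, tree_nil, Algebra.TensorProduct.one_def]

/-! Co-associativity, co-unit and antipode. -/

theorem δ_comp_V : δ ∘ₗ V = V.rTensor Htree ∘ₗ δ := lin_ext δ_V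

theorem δ_mul_V (x y : Htree) : δ (x * V y) = Δ x * δ (V y) := by
  have h : ((LinearMap.mul ℂ Htree).compl₂ V).compr₂ δ =
      (LinearMap.mul ℂ (Htree ⊗[ℂ] Htree)).compl₁₂ Δ.toLinearMap (δ ∘ₗ V) := by
    refine lin_ext fun t => lin_ext fun s => ?_
    simp only [LinearMap.compr₂_apply, LinearMap.compl₂_apply, LinearMap.compl₁₂_apply,
      LinearMap.mul_apply', AlgHom.toLinearMap_apply, LinearMap.comp_apply]
    rw [← tree_node, δ_node]
  exact congrArg (fun f => f x y) h

/-- `(Δ ⊗ Id) w`, re-associated. -/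
abbrev ΔL : Htree ⊗[ℂ] Htree →ₐ[ℂ] Htree ⊗[ℂ] (Htree ⊗[ℂ] Htree) :=
  (Algebra.TensorProduct.assoc ℂ ℂ ℂ Htree Htree Htree).toAlgHom.comp
    (Algebra.TensorProduct.map Δ (.id ℂ Htree))

/-- `(δ ⊗ Id) w`, re-associated. -/
abbrev δL : Htree ⊗[ℂ] Htree →ₗ[ℂ] Htree ⊗[ℂ] (Htree ⊗[ℂ] Htree) :=
  (TensorProduct.assoc ℂ Htree Htree Htree).toLinearMap ∘ₗ δ.rTensor Htree

/-- `(Id ⊗ Δ) w`. -/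
abbrev ΔR : Htree ⊗[ℂ] Htree →ₐ[ℂ] Htree ⊗[ℂ] (Htree ⊗[ℂ] Htree) :=
  Algebra.TensorProduct.map (.id ℂ Htree) Δ

theorem δL_mul (w v : Htree ⊗[ℂ] Htree) :
    δL (w * V.rTensor Htree v) = ΔL w * δL (V.rTensor Htree v) := by
  induction w with
  | zero => simp
  | add w₁ w₂ h₁ h₂ => simp only [add_mul, map_add, h₁, h₂]
  | tmul w₁ w₂ =>
    induction v with
    | zero => simp
    | add v₁ v₂ h₁ h₂ => simp only [mul_add, map_add, h₁, h₂]
    | tmul v₁ v₂ =>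
      have e : ∀ z : Htree ⊗[ℂ] Htree, ∀ y : Htree,
          (TensorProduct.assoc ℂ Htree Htree Htree) (z ⊗ₜ y) =
          (Algebra.TensorProduct.assoc ℂ ℂ ℂ Htree Htree Htree).toAlgHom (z ⊗ₜ y) :=
        fun _ _ => rfl
      simp only [LinearMap.rTensor_tmul, Algebra.TensorProduct.tmul_mul_tmul,
        LinearMap.comp_apply, LinearEquiv.coe_coe, δ_mul_V, AlgHom.comp_apply, e,
        Algebra.TensorProduct.map_tmul, AlgHom.id_apply, ← map_mul]

theorem δL_V (w : Htree ⊗[ℂ] Htree) :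
    δL (V.rTensor Htree w) = V.rTensor (Htree ⊗[ℂ] Htree) (δL w) := by
  induction w with
  | zero => simp
  | add w₁ w₂ h₁ h₂ => simp only [map_add, h₁, h₂]
  | tmul x y =>
    have h : δ (V x) = V.rTensor Htree (δ x) := congrArg (fun f => f x) δ_comp_V
    simp only [LinearMap.rTensor_tmul, LinearMap.comp_apply, LinearEquiv.coe_coe, h]
    induction δ x with
    | zero => simp
    | add w₁ w₂ h₁ h₂ => simp only [map_add, TensorProduct.add_tmul, h₁, h₂]
    | tmul x y => simp

theorem ΔR_V (w : Htree ⊗[ℂ] Htree) :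
    ΔR (V.rTensor Htree w) = V.rTensor (Htree ⊗[ℂ] Htree) (ΔR w) := by
  induction w with
  | zero => simp
  | add w₁ w₂ h₁ h₂ => simp only [map_add, h₁, h₂]
  | tmul x y => simp

theorem ΔL_V (w : Htree ⊗[ℂ] Htree) :
    ΔL (V.rTensor Htree w) = 1 ⊗ₜ V.rTensor Htree w + δL (V.rTensor Htree w) := by
  induction w with
  | zero => simp
  | add w₁ w₂ h₁ h₂ =>
    simp only [map_add, h₁, h₂, TensorProduct.tmul_add]
    abel
  | tmul x y =>
    have h : Δ.toLinearMap ∘ₗ V = (TensorProduct.mk ℂ Htree Htree 1) ∘ₗ V + δ ∘ₗ V :=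
      lin_ext fun t => by
        simpa [tree_nil] using Δ_V t
    have h' : Δ (V x) = 1 ⊗ₜ V x + δ (V x) := congrArg (fun f => f x) h
    simp only [AlgHom.comp_apply, LinearMap.comp_apply, LinearMap.rTensor_tmul,
      Algebra.TensorProduct.map_tmul, h', TensorProduct.add_tmul, map_add]
    rfl

theorem coassoc_aux (t : PBT) :
    ΔL (Δ (tree t)) = ΔR (Δ (tree t)) ∧ δL (δ (tree t)) = ΔR (δ (tree t)) := by
  induction t with
  | nil =>
    constructor
    · rw [tree_nil]; simp only [map_one]
    · rw [δ_nil, tree_nil]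
      have h : δ 1 = 1 ⊗ₜ 1 := by rw [← tree_nil, δ_nil]
      simp [h, Algebra.TensorProduct.one_def]
  | node _ r s hr hs =>
    have h1 : δL (δ (V (tree s))) = ΔR (δ (V (tree s))) := by
      rw [δ_V, δL_V, hs.2, ΔR_V]
    constructor
    · rw [Δ_node, map_mul, map_mul, hr.1]
      congr 1
      rw [Δ_V, map_add, map_add, ← h1, δ_V, ΔL_V, tree_nil, ← δ_V]
      simp only [AlgHom.comp_apply, Algebra.TensorProduct.map_tmul, map_one, AlgHom.id_apply, Δ_V,
        TensorProduct.tmul_add, tree_nil, Algebra.TensorProduct.one_def]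
      rw [add_assoc]
      rfl
    · rw [δ_node, map_mul ΔR, ← h1, ← hr.1, δ_V, δL_mul]

/-- `δ` is a right co-action: `(δ ⊗ Id) δ = (Id ⊗ Δ) δ`. -/
theorem δ_coaction (x : Htree) :
    TensorProduct.assoc ℂ Htree Htree Htree (δ.rTensor Htree (δ x)) =
      Δ.toLinearMap.lTensor Htree (δ x) := by
  have : δL ∘ₗ δ = ΔR.toLinearMap ∘ₗ δ := lin_ext fun t => (coassoc_aux t).2
  exact congrArg (fun f => f x) this

theorem counit_aux (t : PBT) :
    (Algebra.TensorProduct.map (.id ℂ Htree) ε) (Δ (tree t)) = tree t ⊗ₜ 1 ∧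
      (Algebra.TensorProduct.map (.id ℂ Htree) ε) (δ (tree t)) = tree t ⊗ₜ 1 := by
  have hV : ∀ w : Htree ⊗[ℂ] Htree, (Algebra.TensorProduct.map (.id ℂ Htree) ε)
      (V.rTensor Htree w) = V.rTensor ℂ ((Algebra.TensorProduct.map (.id ℂ Htree) ε) w) := by
    intro w
    induction w with
    | zero => simp
    | add w₁ w₂ h₁ h₂ => simp only [map_add, h₁, h₂]
    | tmul x y => simp
  induction t with
  | nil => simp [Δ_nil, δ_nil, ε_nil]
  | node _ r s hr hs =>
    rw [Δ_node, δ_node, map_mul, map_mul, hr.1, Δ_V, map_add, δ_V, hV, hs.2, V_tree]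
    simp [ε_node, tree_node r s, V_tree]

theorem ε_V (x : Htree) : ε (V x) = 0 := by
  have : ε.toLinearMap ∘ₗ V = 0 := lin_ext fun t => by simp [V_tree, ε_node]
  exact congrArg (fun f => f x) this

theorem counit_aux' (t : PBT) :
    (Algebra.TensorProduct.map ε (.id ℂ Htree)) (Δ (tree t)) = 1 ⊗ₜ tree t := by
  have hV : ∀ w : Htree ⊗[ℂ] Htree, (Algebra.TensorProduct.map ε (.id ℂ Htree))
      (V.rTensor Htree w) = 0 := by
    intro w
    induction w with
    | zero => simp
    | add w₁ w₂ h₁ h₂ => simp only [map_add, h₁, h₂, add_zero]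
    | tmul x y => simp [ε_V]
  induction t with
  | nil => simp [Δ_nil, ε_nil]
  | node _ r s hr _ =>
    rw [Δ_node, map_mul, hr, Δ_V, map_add, δ_V, hV]
    simp [ε_nil, tree_node r s]

instance instBialgebra : Bialgebra ℂ Htree :=
  Bialgebra.ofAlgHom Δ ε (hom_ext fun t => (coassoc_aux t).1) (hom_ext counit_aux')
    (hom_ext fun t => (counit_aux t).1)

/-- For `w = ∑ x ⊗ y` in `H ⊗ Hᵒᵖ`, the element `∑ x * y`. -/
def mulOp : Htree ⊗[ℂ] Htreeᵐᵒᵖ →ₗ[ℂ] Htree :=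
  LinearMap.mul' ℂ Htree ∘ₗ (MulOpposite.opLinearEquiv ℂ).symm.toLinearMap.lTensor Htree

/-- Simultaneous recursion for `(Id ⊗ S) Δ`, `(Id ⊗ S) δ` and the antipode `S`, the latter as an
anti-homomorphism, with `S V(s) = - m (Id ⊗ S) δ V(s)`. -/
def antipodeAux : PBT →
    (Htree ⊗[ℂ] Htreeᵐᵒᵖ) × (Htree ⊗[ℂ] Htreeᵐᵒᵖ) × Htreeᵐᵒᵖ
  | .nil => (1, 1, 1)
  | .node _ r s =>
    let w := V.rTensor Htreeᵐᵒᵖ (antipodeAux s).2.1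
    let v := -MulOpposite.op (mulOp w)
    ((antipodeAux r).1 * (1 ⊗ₜ v + w), (antipodeAux r).1 * w, (antipodeAux r).2.2 * v)

theorem antipodeAux_mul (t s : PBT) :
    (antipodeAux (t * s)).2.2 = (antipodeAux t).2.2 * (antipodeAux s).2.2 := by
  induction s with
  | nil => rw [← PBT.one_def, mul_one, PBT.one_def, antipodeAux, mul_one]
  | node _ r u hr _ => rw [PBT.mul_node]; simp only [antipodeAux, hr, mul_assoc]

/-- The antipode as an algebra map to the opposite algebra. -/
def Sop : Htree →ₐ[ℂ] Htreeᵐᵒᵖ := lift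
  { toFun := fun t => (antipodeAux t).2.2
    map_one' := rfl
    map_mul' := antipodeAux_mul }

/-- The antipode. -/
def S : Htree →ₗ[ℂ] Htree := unopLin Sop

theorem Sop_V (s : PBT) : Sop (V (tree s)) =
    -MulOpposite.op (mulOp (V.rTensor Htreeᵐᵒᵖ (antipodeAux s).2.1)) := by
  rw [V_tree]
  refine (lift_tree _ _).trans ?_
  exact one_mul (M := Htreeᵐᵒᵖ) _

theorem antipodeAux_eq (t : PBT) :
    Algebra.TensorProduct.map (.id ℂ Htree) Sop (Δ (tree t)) = (antipodeAux t).1 ∧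
      Algebra.TensorProduct.map (.id ℂ Htree) Sop (δ (tree t)) = (antipodeAux t).2.1 := by
  have hV : ∀ w : Htree ⊗[ℂ] Htree, (Algebra.TensorProduct.map (.id ℂ Htree) Sop)
      (V.rTensor Htree w) =
      V.rTensor Htreeᵐᵒᵖ ((Algebra.TensorProduct.map (.id ℂ Htree) Sop) w) := by
    intro w
    induction w with
    | zero => simp
    | add w₁ w₂ h₁ h₂ => simp only [map_add, h₁, h₂]
    | tmul x y => simp
  induction t with
  | nil => simp [tree_nil, δ_one, antipodeAux]
  | node _ r s hr hs =>
    rw [Δ_node, δ_node, map_mul, map_mul, hr.1, Δ_V, map_add, δ_V, hV, hs.2]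
    simp [antipodeAux, Sop_V, tree_nil]

theorem right_antipode (x : Htree) :
    LinearMap.mul' ℂ Htree (S.lTensor Htree (Δ x)) = algebraMap ℂ Htree (ε x) := by
  have h0 : ∀ w : Htree ⊗[ℂ] Htree, LinearMap.mul' ℂ Htree (S.lTensor Htree w) =
      mulOp (Algebra.TensorProduct.map (.id ℂ Htree) Sop w) := by
    intro w
    induction w with
    | zero => simp
    | add w₁ w₂ h₁ h₂ => simp only [map_add, h₁, h₂]
    | tmul x y => simp [mulOp, S, unopLin]
  have h : LinearMap.mul' ℂ Htree ∘ₗ S.lTensor Htree ∘ₗ Δ.toLinearMap =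
      Algebra.linearMap ℂ Htree ∘ₗ ε.toLinearMap := by
    refine lin_ext fun t => ?_
    simp only [LinearMap.comp_apply, AlgHom.toLinearMap_apply, Algebra.linearMap_apply]
    cases t with
    | nil => simp [tree_nil, S, unopLin_one, Algebra.TensorProduct.one_def]
    | node _ r s =>
      have hV : LinearMap.mul' ℂ Htree (S.lTensor Htree (Δ (V (tree s)))) =
          algebraMap ℂ Htree 0 := by
        rw [h0]
        have e := (antipodeAux_eq (.node () .nil s)).1
        rw [V_tree, e]
        have e2 := Sop_V s
        simp [antipodeAux, mulOp]
      rw [Δ_node, S, right_aux _ _ _ _ hV, ε_node]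
      simp
  exact congrArg (fun f => f x) h

/-- The convolution product of the antipode with the identity. -/
def X : Htree →ₗ[ℂ] Htree := LinearMap.mul' ℂ Htree ∘ₗ S.rTensor Htree ∘ₗ Δ.toLinearMap

theorem mul_X (x : Htree) : LinearMap.mul' ℂ Htree (X.lTensor Htree (Δ x)) = x := by
  have h : WithConv.toConv (LinearMap.id (R := ℂ) (M := Htree)) * WithConv.toConv S = 1 := by
    ext x
    exact right_antipode x
  have h2 : WithConv.toConv (LinearMap.id (R := ℂ) (M := Htree)) * (WithConv.toConv S *
      WithConv.toConv (LinearMap.id (R := ℂ) (M := Htree))) =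
      WithConv.toConv (LinearMap.id (R := ℂ) (M := Htree)) := by
    rw [← mul_assoc, h, one_mul]
  exact congrArg (fun f => f.ofConv x) h2

theorem lTensor_X_mul (u : Htree) (v w : Htree ⊗[ℂ] Htree) (h : X.lTensor Htree v = u ⊗ₜ 1) :
    X.lTensor Htree (v * w) = (u ⊗ₜ 1) * X.lTensor Htree w := by
  induction w with
  | zero => simp
  | add w₁ w₂ h₁ h₂ => simp only [mul_add, map_add, h₁, h₂]
  | tmul w₁ w₂ =>
    have key : X.lTensor Htree (v * (w₁ ⊗ₜ w₂)) =
        TensorProduct.map (LinearMap.mulRight ℂ w₁) (LinearMap.mul' ℂ Htree ∘ₗ S.rTensor Htree ∘ₗ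
          LinearMap.mulRight ℂ (Δ w₂) ∘ₗ TensorProduct.mk ℂ Htree Htree 1)
          (X.lTensor Htree v) := by
      clear h
      induction v with
      | zero => simp
      | add v₁ v₂ h₁ h₂ => simp only [add_mul, map_add, h₁, h₂]
      | tmul v₁ v₂ =>
        have e : X (v₂ * w₂) =
            LinearMap.mul' ℂ Htree (S.rTensor Htree ((1 ⊗ₜ X v₂) * Δ w₂)) := by
          simp only [X, LinearMap.comp_apply, AlgHom.toLinearMap_apply, map_mul]
          exact left_gen Sop _ _
        simp [e]
    rw [key, h, TensorProduct.map_tmul]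
    simp [X, ← Algebra.TensorProduct.one_def]

theorem X_aux (t : PBT) : X.lTensor Htree (Δ (tree t)) = tree t ⊗ₜ 1 ∧
    X.lTensor Htree (δ (tree t)) = tree t ⊗ₜ 1 ∧
    X (tree t) = algebraMap ℂ Htree (ε (tree t)) := by
  have hV : ∀ w : Htree ⊗[ℂ] Htree, X.lTensor Htree (V.rTensor Htree w) =
      V.rTensor Htree (X.lTensor Htree w) := by
    intro w
    induction w with
    | zero => simp
    | add w₁ w₂ h₁ h₂ => simp only [map_add, h₁, h₂]
    | tmul x y => simp
  have hX1 : X 1 = 1 := by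
    simp [X, Algebra.TensorProduct.one_def, S, unopLin_one]
  induction t with
  | nil => simp [tree_nil, δ_one, Algebra.TensorProduct.one_def, hX1]
  | node _ r s hr hs =>
    have h1 : X.lTensor Htree (δ (V (tree s))) = V (tree s) ⊗ₜ 1 := by
      rw [δ_V, hV, hs.2.1, LinearMap.rTensor_tmul]
    have h2 : X (V (tree s)) = 0 := by
      have := mul_X (V (tree s))
      rw [Δ_V, map_add, h1, tree_nil] at this
      simpa using this
    refine ⟨?_, ?_, ?_⟩
    · rw [Δ_node, lTensor_X_mul _ _ _ hr.1, Δ_V, map_add, h1, LinearMap.lTensor_tmul, h2]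
      simp only [TensorProduct.tmul_zero, zero_add,
        Algebra.TensorProduct.tmul_mul_tmul, mul_one]
      exact congrArg (fun z => z ⊗ₜ[ℂ] (1 : Htree)) (tree_node r s).symm
    · rw [δ_node, lTensor_X_mul _ _ _ hr.1, h1]
      simp only [Algebra.TensorProduct.tmul_mul_tmul, mul_one]
      exact congrArg (fun z => z ⊗ₜ[ℂ] (1 : Htree)) (tree_node r s).symm
    · rw [ε_node, map_zero]
      have e := left_aux Sop (Δ (tree r)) (Δ (V (tree s))) _ hr.2.2
      have e' : LinearMap.mul' ℂ Htree ((unopLin Sop).rTensor Htree (Δ (V (tree s)))) = 0 := h2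
      rw [e', mul_zero, ← Δ_node] at e
      exact e

theorem left_antipode (x : Htree) :
    LinearMap.mul' ℂ Htree (S.rTensor Htree (Δ x)) = algebraMap ℂ Htree (ε x) := by
  have h : X = Algebra.linearMap ℂ Htree ∘ₗ ε.toLinearMap := lin_ext fun t => (X_aux t).2.2
  exact congrArg (fun f => f x) h

instance instHopfAlgebra : HopfAlgebra ℂ Htree where
  antipode := S
  mul_antipode_rTensor_comul := LinearMap.ext left_antipode
  mul_antipode_lTensor_comul := LinearMap.ext right_antipode

/-- `t_n`, the sum of all planar binary trees with `n` internal vertices. -/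
def t (n : ℕ) : Htree := ∑ s ∈ BinaryTree.treesOfNumNodesEq n, tree s

end Htree

/-- The homomorphism of unital algebras with `Ω a_n = t_n` for `n ≥ 1`. -/
def Ω : Hdif →ₐ[ℂ] Htree := Hdif.lift fun n => Htree.t (n + 1)

end NCDiff

end

open NCDiff

/-! Put `α = ∑ aₙxⁿ`, `T = ∑ tₙxⁿ`, and write `F ⋆ G = ∑ fₖ ⊗ (xG)ᵏ`, which is a ring homomorphism
in `F`. The co-product of `Hdif` reads `Δ(xα) = xα ⋆ α`. Splitting off the right-most factor `V(s)`
of every tree gives `T = 1 + T · xV(T)`. Applying `Δ` and `δ` to it yields `ΔT = δT · (1 ⊗ T)` and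
then `δT = 1 + δT · x(1 ⊗ T) · (V ⊗ id)(δT)`. This equation has only one solution and `T ⋆ T` is
one, so `δT = T ⋆ T` and `Δ(xT) = xT ⋆ T`, which says that `Ω : α ↦ T` respects co-products.

The trees form the free monoid on the `V(s)`, so a retraction of `Ω` may be prescribed on these
generators, and `T ↦ α` only asks that `V(T)` be sent to the solution `β` of `α = 1 + α · xβ`. -/

noncomputable section

namespace NCDiff

open PowerSeries
open Finset hiding antidiagonal mem_antidiagonal
open Finset.HasAntidiagonal

theorem antipode_bialgHom_apply {R A B : Type*} [CommSemiring R] [Semiring A] [Semiring B]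
    [HopfAlgebra R A] [HopfAlgebra R B] (f : A →ₐc[R] B) (x : A) :
    HopfAlgebra.antipode R (f x) = f (HopfAlgebra.antipode R x) := by
  have h₁ : WithConv.toConv ((f : A →ₐ[R] B).toLinearMap ∘ₗ HopfAlgebra.antipode R) *
      WithConv.toConv (f : A →ₐ[R] B).toLinearMap = 1 := by
    have h := LinearMap.algHom_comp_convMul_distrib (f : A →ₐ[R] B)
      (WithConv.toConv (HopfAlgebra.antipode R (A := A))) (WithConv.toConv LinearMap.id)
    rw [LinearMap.antipode_mul_id] at h
    refine (congrArg WithConv.toConv h).symm.trans ?_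
    ext y
    exact (f : A →ₐ[R] B).commutes _
  have h₂ : WithConv.toConv (f : A →ₐ[R] B).toLinearMap *
      WithConv.toConv (HopfAlgebra.antipode R ∘ₗ (f : A →ₐ[R] B).toLinearMap) = 1 := by
    have h := LinearMap.convMul_comp_coalgHom_distrib (WithConv.toConv LinearMap.id)
      (WithConv.toConv (HopfAlgebra.antipode R (A := B))) (f : A →ₗc[R] B)
    rw [LinearMap.id_mul_antipode] at h
    refine (congrArg WithConv.toConv h).symm.trans ?_
    ext y
    exact congrArg (algebraMap R B) (CoalgHomClass.counit_comp_apply f y)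
  have h := left_inv_eq_right_inv h₁ h₂
  exact (congrArg (fun g => g.ofConv x) h).symm

theorem isHopfSubalgebra_range {A B : Type*} [Ring A] [Ring B] [HopfAlgebra ℂ A]
    [HopfAlgebra ℂ B] (f : A →ₐc[ℂ] B) : IsHopfSubalgebra (f : A →ₐ[ℂ] B).range := by
  refine ⟨?_, ?_⟩
  · rintro _ ⟨x, rfl⟩
    have h : Coalgebra.comul (R := ℂ) (f x) =
        TensorProduct.map (f : A →ₐ[ℂ] B).toLinearMap (f : A →ₐ[ℂ] B).toLinearMap
          (Coalgebra.comul (R := ℂ) x) :=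
      (CoalgHomClass.map_comp_comul_apply f x).symm
    have e : (f : A →ₐ[ℂ] B).toLinearMap = (f : A →ₐ[ℂ] B).range.val.toLinearMap ∘ₗ
        (f : A →ₐ[ℂ] B).rangeRestrict.toLinearMap := rfl
    rw [e, TensorProduct.map_comp] at h
    exact ⟨_, h.symm⟩
  · rintro _ ⟨x, rfl⟩
    exact ⟨_, (antipode_bialgHom_apply f x).symm⟩

theorem sum_antidiagonalTuple_succ {M : Type*} [AddCommMonoid M] (k n : ℕ)
    (f : (Fin (k + 1) → ℕ) → M) :
    ∑ x ∈ Nat.antidiagonalTuple (k + 1) n, f x =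
      ∑ p ∈ antidiagonal n, ∑ x ∈ Nat.antidiagonalTuple k p.2, f (Fin.cons p.1 x) := by
  rw [sum_sigma']
  refine sum_bij' (fun x _ => ⟨(x 0, ∑ i, Fin.tail x i), Fin.tail x⟩)
    (fun y _ => Fin.cons y.1.1 y.2) ?_ ?_ ?_ ?_ ?_
  · intro x hx
    rw [Nat.mem_antidiagonalTuple, Fin.sum_univ_succ] at hx
    simpa [Nat.mem_antidiagonalTuple, Fin.tail] using hx
  · rintro ⟨⟨i, j⟩, x⟩ hx
    simp only [mem_sigma, mem_antidiagonal, Nat.mem_antidiagonalTuple] at hx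
    simp [Nat.mem_antidiagonalTuple, Fin.sum_univ_succ, hx]
  · intro x _
    exact Fin.cons_self_tail x
  · rintro ⟨⟨i, j⟩, x⟩ hx
    simp only [mem_sigma, Nat.mem_antidiagonalTuple] at hx
    simp [hx.2]
  · intro x _
    rw [Fin.cons_self_tail]

theorem Qpoly_eq_coeff_pow {R : Type*} [Semiring R] (c : ℕ → R) (N m : ℕ) :
    Qpoly c N m = coeff m (mk c ^ N) := by
  induction N generalizing m with
  | zero => cases m <;> simp [Qpoly, coeff_one]
  | succ N ih =>
    rw [Qpoly, sum_antidiagonalTuple_succ, pow_succ', coeff_mul]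
    refine sum_congr rfl fun p _ => ?_
    rw [← ih, Qpoly, coeff_mk, mul_sum]
    simp

theorem sum_antidiagonal_antidiagonal_comm {N M : Type*} [AddCommMonoid N] [HasAntidiagonal N]
    [AddCommMonoid M] (n : N) (f : N → N → N → N → M) :
    ∑ p ∈ antidiagonal n, ∑ x ∈ antidiagonal p.1, ∑ y ∈ antidiagonal p.2, f x.1 x.2 y.1 y.2 =
      ∑ p ∈ antidiagonal n, ∑ x ∈ antidiagonal p.1, ∑ y ∈ antidiagonal p.2, f x.1 y.1 x.2 y.2 := by
  simp only [sum_sigma']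
  let swap (z : (_ : N × N) × (_ : N × N) × N × N) : (_ : N × N) × (_ : N × N) × N × N :=
    ⟨(z.2.1.1 + z.2.2.1, z.2.1.2 + z.2.2.2), (z.2.1.1, z.2.2.1), z.2.1.2, z.2.2.2⟩
  refine sum_nbij' swap swap ?_ ?_ ?_ ?_ ?_
  all_goals
    rintro ⟨⟨_, _⟩, ⟨_, _⟩, _, _⟩ h
    simp only [mem_sigma, mem_antidiagonal] at h
    obtain ⟨rfl, rfl, rfl⟩ := h
    simp [swap, add_add_add_comm]

theorem eq_mul_of_eq_add_mul_X_mul {A : Type*} [Ring A] {F G H U : A⟦X⟧}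
    (hF : F = G + F * (X * U)) (hH : H = 1 + H * (X * U)) : F = G * H := by
  obtain ⟨J, hJ⟩ : ∃ J, (1 - X * U) * J = 1 := ⟨_, mul_invOfUnit (1 - X * U) 1 (by simp)⟩
  have hF' : F * (1 - X * U) = G := by rwa [mul_sub, mul_one, sub_eq_iff_eq_add]
  have hH' : H * (1 - X * U) = 1 := by rwa [mul_sub, mul_one, sub_eq_iff_eq_add]
  rw [left_inv_eq_right_inv hH' hJ, ← hF', mul_assoc, hJ, mul_one]

theorem coeff_succ_mul_X_mul {A : Type*} [Semiring A] (F G : A⟦X⟧) (n : ℕ) :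
    coeff (n + 1) (F * (X * G)) = coeff n (F * G) := by
  rw [← mul_assoc, (commute_X F).eq, mul_assoc, coeff_succ_X_mul]

section MapCoeff

variable {R A B : Type*} [CommSemiring R] [Semiring A] [Semiring B] [Module R A] [Module R B]

/-- The power series obtained by applying a linear map, not assumed multiplicative, to every
coefficient; for ring homomorphisms `PowerSeries.map` is used instead. -/
def mapCoeff (φ : A →ₗ[R] B) (F : A⟦X⟧) : B⟦X⟧ := .mk fun n => φ (coeff n F)

@[simp]
theorem coeff_mapCoeff (φ : A →ₗ[R] B) (F : A⟦X⟧) (n : ℕ) :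
    coeff n (mapCoeff φ F) = φ (coeff n F) :=
  coeff_mk _ _

theorem eq_of_eq_one_add_mul_X_mul_mapCoeff {W F G : A⟦X⟧} (φ : A →ₗ[R] A)
    (hF : F = 1 + F * (X * (W * mapCoeff φ F))) (hG : G = 1 + G * (X * (W * mapCoeff φ G))) :
    F = G := by
  ext n
  induction n using Nat.strong_induction_on with
  | _ n ih =>
  rw [hF, hG]
  cases n with
  | zero => simp
  | succ n =>
    have hφ (m : ℕ) (hm : m ≤ n) : coeff m (W * mapCoeff φ F) = coeff m (W * mapCoeff φ G) := by
      rw [coeff_mul, coeff_mul]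
      refine sum_congr rfl fun q hq => ?_
      rw [coeff_mapCoeff, coeff_mapCoeff, ih q.2 (by have := mem_antidiagonal.1 hq; omega)]
    rw [map_add, map_add, coeff_succ_mul_X_mul, coeff_succ_mul_X_mul, coeff_mul, coeff_mul]
    refine congrArg _ (sum_congr rfl fun p hp => ?_)
    have := mem_antidiagonal.1 hp
    rw [ih p.1 (by omega), hφ p.2 (by omega)]

end MapCoeff

section TensorSubst

variable {R A A' B B' : Type*} [CommSemiring R] [Semiring A] [Semiring A'] [Semiring B]
  [Semiring B'] [Algebra R A] [Algebra R A'] [Algebra R B] [Algebra R B']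

/-- The substitution `∑ fₖ xᵏ ↦ ∑ fₖ ⊗ (x G)ᵏ` of `x G(x)` for the variable, the coefficients of
the two series being kept in separate tensor factors. Since `xᵏ` is central, the coefficient of `xⁿ`
is the finite sum of the `fₖ ⊗ [xᵐ] Gᵏ` over `k + m = n`. -/
def tensorSubst (G : B⟦X⟧) : A⟦X⟧ →+* (A ⊗[R] B)⟦X⟧ where
  toFun F := .mk fun n => ∑ p ∈ antidiagonal n, coeff p.1 F ⊗ₜ coeff p.2 (G ^ p.1)
  map_zero' := by ext n; simp
  map_one' := by
    ext n
    rw [coeff_mk, sum_eq_single_of_mem (0, n) (by simp)]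
    · cases n <;> simp [coeff_one, Algebra.TensorProduct.one_def]
    · rintro ⟨i, j⟩ hij hne
      have hi : i ≠ 0 := by rintro rfl; simp_all
      simp [coeff_one, hi]
  map_add' F F' := by ext n; simp [TensorProduct.add_tmul, sum_add_distrib]
  map_mul' F F' := by
    ext n
    have h (p : ℕ × ℕ) : coeff p.1 (F * F') ⊗ₜ[R] coeff p.2 (G ^ p.1) =
        ∑ x ∈ antidiagonal p.1, ∑ y ∈ antidiagonal p.2, (coeff x.1 F * coeff x.2 F') ⊗ₜ[R]
          (coeff y.1 (G ^ x.1) * coeff y.2 (G ^ x.2)) := by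
      rw [coeff_mul, TensorProduct.sum_tmul]
      refine sum_congr rfl fun x hx => ?_
      rw [← mem_antidiagonal.1 hx, pow_add, coeff_mul, TensorProduct.tmul_sum]
    simp only [coeff_mk, coeff_mul n, h, sum_mul_sum, Algebra.TensorProduct.tmul_mul_tmul]
    exact sum_antidiagonal_antidiagonal_comm n fun i j k l =>
      (coeff i F * coeff j F') ⊗ₜ[R] (coeff k (G ^ i) * coeff l (G ^ j))

theorem coeff_tensorSubst (G : B⟦X⟧) (F : A⟦X⟧) (n : ℕ) : coeff n (tensorSubst (R := R) G F) =
    ∑ p ∈ antidiagonal n, coeff p.1 F ⊗ₜ[R] coeff p.2 (G ^ p.1) := by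
  simp [tensorSubst]

variable (R) in
/-- `Algebra.TensorProduct.includeRight` as a ring homomorphism, so that it can be applied to power
series with `PowerSeries.map`. -/
def includeRightRingHom : B →+* A ⊗[R] B :=
  (Algebra.TensorProduct.includeRight : B →ₐ[R] A ⊗[R] B).toRingHom

theorem tensorSubst_X (G : B⟦X⟧) : tensorSubst (R := R) (A := A) G X =
    X * map (includeRightRingHom R) G := by
  ext n
  cases n with
  | zero => simp [coeff_tensorSubst]
  | succ n =>
    rw [coeff_tensorSubst, coeff_succ_X_mul, sum_eq_single_of_mem (1, n) (by simp [add_comm])]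
    · simp [includeRightRingHom]
    · rintro ⟨i, j⟩ hij hne
      have hi : i ≠ 1 := by rintro rfl; simp_all [add_comm]
      simp [coeff_X, hi]

theorem tensorSubst_mapCoeff (φ : A →ₗ[R] A') (G : B⟦X⟧) (F : A⟦X⟧) :
    tensorSubst G (mapCoeff φ F) = mapCoeff (φ.rTensor B) (tensorSubst G F) := by
  ext n
  simp [coeff_tensorSubst]

theorem map_tensorSubst (f : A →ₐ[R] A') (g : B →ₐ[R] B') (G : B⟦X⟧) (F : A⟦X⟧) :
    map (Algebra.TensorProduct.map f g).toRingHom (tensorSubst G F) =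
      tensorSubst (map g.toRingHom G) (map f.toRingHom F) := by
  ext n
  simp [coeff_tensorSubst, ← map_pow]

end TensorSubst

namespace Hdif

/-- The generating series `α = ∑ aₙ xⁿ`, so that `A(x) = x α(x)`. -/
def genSeries : Hdif⟦X⟧ := .mk a

@[simp]
theorem coeff_genSeries (n : ℕ) : coeff n genSeries = a n := coeff_mk _ _

theorem A_eq_X_mul_genSeries : A = X * genSeries := by
  ext n
  cases n with
  | zero => simp [A]
  | succ n => simp [A, coeff_succ_X_mul]

theorem map_Δ_A : map Δ.toRingHom A = tensorSubst genSeries A := by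
  ext m
  have hA : coeff m A = c 1 m := by rw [c, pow_one]
  rw [coeff_map, hA, coeff_tensorSubst, Nat.sum_antidiagonal_eq_sum_range_succ_mk]
  refine (Δ_c_one m (m + 1) m.lt_succ_self).trans (sum_congr rfl fun i hi => ?_)
  rw [c, c, pow_one, A_eq_X_mul_genSeries, (commute_X genSeries).symm.mul_pow, coeff_X_pow_mul',
    if_pos (mem_range_succ_iff.1 hi)]

/-- The series `β` with `α = 1 + α · x β`; it corresponds to `V(T)` in `T = 1 + T · x V(T)`. -/
def vSeries : Hdif⟦X⟧ := invOfUnit genSeries 1 * .mk fun n => a (n + 1)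

theorem genSeries_eq_one_add_mul : genSeries = 1 + genSeries * (X * vSeries) := by
  have h₀ : constantCoeff genSeries = (1 : Hdifˣ) := by simp [genSeries, a]
  calc genSeries = 1 + X * .mk fun n => a (n + 1) := by
        ext n
        cases n with
        | zero => simp [a]
        | succ n => simp [coeff_succ_X_mul, coeff_one]
    _ = 1 + genSeries * (X * vSeries) := by
        rw [← mul_assoc, (commute_X genSeries).eq, mul_assoc, vSeries, ← mul_assoc genSeries,
          mul_invOfUnit genSeries 1 h₀, one_mul]

end Hdif

namespace Htree

theorem t_zero : t 0 = 1 := by simp [t, tree_nil]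

open BinaryTree in
theorem t_succ (n : ℕ) : t (n + 1) = ∑ p ∈ antidiagonal n, t p.1 * V (t p.2) := by
  rw [t, treesOfNumNodesEq_succ, sum_biUnion]
  · refine sum_congr rfl fun p _ => ?_
    rw [sum_map, sum_product, t, t, map_sum, sum_mul_sum]
    exact sum_congr rfl fun r _ => sum_congr rfl fun s _ => tree_node r s
  · simp_rw [Set.PairwiseDisjoint, Set.Pairwise, disjoint_left]
    aesop

theorem Δ_V_apply (x : Htree) : Δ (V x) = 1 ⊗ₜ V x + δ (V x) := by
  have h : Δ.toLinearMap ∘ₗ V = TensorProduct.mk ℂ Htree Htree 1 ∘ₗ V + δ ∘ₗ V :=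
    lin_ext fun s => by simpa [tree_nil] using Δ_V s
  exact LinearMap.congr_fun h x

theorem δ_V_apply (x : Htree) : δ (V x) = V.rTensor Htree (δ x) :=
  LinearMap.congr_fun δ_comp_V x

end Htree

open NCDiff.Htree hiding X

/-- The generating series `T = ∑ tₙ xⁿ`. -/
def treeSeries : Htree⟦X⟧ := .mk t

@[simp]
theorem coeff_treeSeries (n : ℕ) : coeff n treeSeries = t n := coeff_mk _ _

theorem treeSeries_eq_one_add_mul :
    treeSeries = 1 + treeSeries * (X * mapCoeff V treeSeries) := by
  ext n
  cases n with
  | zero => simp [treeSeries, t_zero]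
  | succ n =>
    rw [map_add, coeff_succ_mul_X_mul]
    simp [t_succ, coeff_mul, coeff_one]

theorem map_treeSeries_eq_one_add_mul {S : Type*} [Semiring S] (f : Htree →+* S) :
    map f treeSeries = 1 + map f treeSeries * (X * map f (mapCoeff V treeSeries)) := by
  nth_rw 1 [treeSeries_eq_one_add_mul]
  simp only [map_add, map_one, map_mul, map_X]

theorem mapCoeff_δ_treeSeries_eq_one_add_mul : mapCoeff δ treeSeries =
    1 + map Δ.toRingHom treeSeries * (X * mapCoeff (V.rTensor Htree) (mapCoeff δ treeSeries)) := by
  ext n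
  cases n with
  | zero => simp [treeSeries, mapCoeff, t_zero, δ_one]
  | succ n =>
    rw [map_add, coeff_succ_mul_X_mul]
    simp [t_succ, δ_mul_V, δ_V_apply, coeff_mul, coeff_one]

theorem map_Δ_mapCoeff_V_treeSeries : map Δ.toRingHom (mapCoeff V treeSeries) =
    map (includeRightRingHom ℂ) (mapCoeff V treeSeries) +
      mapCoeff (V.rTensor Htree) (mapCoeff δ treeSeries) := by
  ext n
  simp [Δ_V_apply, δ_V_apply, includeRightRingHom]

theorem map_Δ_treeSeries_eq_mapCoeff_δ_mul : map Δ.toRingHom treeSeries =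
    mapCoeff δ treeSeries * map (includeRightRingHom ℂ) treeSeries := by
  refine eq_mul_of_eq_add_mul_X_mul ?_ (map_treeSeries_eq_one_add_mul _)
  nth_rw 1 [map_treeSeries_eq_one_add_mul, mapCoeff_δ_treeSeries_eq_one_add_mul]
  rw [map_Δ_mapCoeff_V_treeSeries, mul_add, mul_add, add_right_comm, add_assoc]

theorem mapCoeff_δ_treeSeries : mapCoeff δ treeSeries = tensorSubst treeSeries treeSeries := by
  refine eq_of_eq_one_add_mul_X_mul_mapCoeff (W := map (includeRightRingHom ℂ) treeSeries)
    (V.rTensor Htree) ?_ ?_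
  · nth_rw 1 [mapCoeff_δ_treeSeries_eq_one_add_mul]
    rw [map_Δ_treeSeries_eq_mapCoeff_δ_mul, mul_assoc, ← mul_assoc _ X, (commute_X _).eq,
      mul_assoc]
  · nth_rw 2 [treeSeries_eq_one_add_mul]
    rw [map_add, map_one, map_mul, map_mul, tensorSubst_X, tensorSubst_mapCoeff, mul_assoc X]

theorem map_Δ_X_mul_treeSeries :
    map Δ.toRingHom (X * treeSeries) = tensorSubst treeSeries (X * treeSeries) := by
  rw [← (commute_X treeSeries).eq, map_mul, map_X, map_Δ_treeSeries_eq_mapCoeff_δ_mul,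
    mapCoeff_δ_treeSeries, map_mul, tensorSubst_X, mul_assoc, (commute_X _).eq]

theorem δ_t (n : ℕ) : δ (t n) = ∑ k ∈ range (n + 1), t k ⊗ₜ[ℂ] Qpoly t k (n - k) := by
  rw [← coeff_treeSeries, ← coeff_mapCoeff, mapCoeff_δ_treeSeries, coeff_tensorSubst,
    Nat.sum_antidiagonal_eq_sum_range_succ_mk]
  simp only [Qpoly_eq_coeff_pow, coeff_treeSeries]
  rfl

theorem Ω_a (n : ℕ) : Ω (Hdif.a n) = t n := by
  cases n with
  | zero => simp [Hdif.a, t_zero]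
  | succ n => exact Hdif.lift_a _ n

theorem map_Ω_genSeries : map Ω.toRingHom Hdif.genSeries = treeSeries := by
  ext n
  simp [Ω_a]

theorem counit_comp_Ω :
    (Bialgebra.counitAlgHom ℂ Htree).comp Ω = Bialgebra.counitAlgHom ℂ Hdif := by
  refine Hdif.hom_ext fun n => Eq.trans ?_ (Hdif.lift_a _ n).symm
  change ε (Ω (Hdif.a (n + 1))) = 0
  simp [Ω_a, t_succ, ε_V]

theorem map_comp_comul_Ω : (Algebra.TensorProduct.map Ω Ω).comp (Bialgebra.comulAlgHom ℂ Hdif) =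
    (Bialgebra.comulAlgHom ℂ Htree).comp Ω := by
  have h : map (Algebra.TensorProduct.map Ω Ω).toRingHom (map Hdif.Δ.toRingHom Hdif.A) =
      map Δ.toRingHom (X * treeSeries) := by
    rw [Hdif.map_Δ_A, map_tensorSubst, map_Δ_X_mul_treeSeries, Hdif.A_eq_X_mul_genSeries, map_mul,
      map_X, map_Ω_genSeries]
  refine Hdif.hom_ext fun n => ?_
  change Algebra.TensorProduct.map Ω Ω (Hdif.Δ (Hdif.a (n + 1))) = Δ (Ω (Hdif.a (n + 1)))
  simpa [Hdif.A, Ω_a, coeff_succ_X_mul] using congrArg (coeff (n + 2)) h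

/-- `Ω` as a homomorphism of bialgebras. -/
def ΩBialgHom : Hdif →ₐc[ℂ] Htree := BialgHom.ofAlgHom Ω counit_comp_Ω map_comp_comul_Ω

/-- The monoid homomorphism with `V(s) ↦ f s`: under the over product the trees form the free
monoid on the trees `V(s) = | ∨ s`, the factorization being `r ∨ s = r / V(s)`. -/
def PBT.lift {M : Type*} [Monoid M] (f : PBT → M) : PBT →* M where
  toFun r := BinaryTree.rec 1 (fun _ _ s x _ => x * f s) r
  map_one' := rfl
  map_mul' r s := by
    induction s with
    | nil => exact (mul_one _).symm
    | node _ u v hu _ => exact (congrArg (· * f v) hu).trans (mul_assoc _ _ _)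

theorem PBT.lift_node_nil {M : Type*} [Monoid M] (f : PBT → M) (s : PBT) :
    PBT.lift f (.node () .nil s) = f s :=
  one_mul (f s)

/-- A left inverse of `Ω`. It has to send the sum of the `V(s)` over the `catalan n` trees `s` with
`n` internal vertices to `[xⁿ] β`, and here each of them gets an equal share. -/
def retraction : Htree →ₐ[ℂ] Hdif :=
  Htree.lift (PBT.lift fun s => (catalan s.numNodes : ℂ)⁻¹ • coeff s.numNodes Hdif.vSeries)

theorem catalan_ne_zero (n : ℕ) : catalan n ≠ 0 := fun h =>
  n.centralBinom_ne_zero <| by rw [← succ_mul_catalan_eq_centralBinom, h, mul_zero]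

theorem retraction_V_t (n : ℕ) : retraction (V (t n)) = coeff n Hdif.vSeries := by
  have h (s : PBT) (hs : s ∈ BinaryTree.treesOfNumNodesEq n) :
      retraction (V (tree s)) = (catalan n : ℂ)⁻¹ • coeff n Hdif.vSeries := by
    rw [V_tree, retraction, lift_tree, PBT.lift_node_nil, BinaryTree.mem_treesOfNumNodesEq.1 hs]
  rw [t, map_sum, map_sum, sum_congr rfl h, sum_const,
    BinaryTree.treesOfNumNodesEq_card_eq_catalan, ← Nat.cast_smul_eq_nsmul ℂ, smul_smul,
    mul_inv_cancel₀ (Nat.cast_ne_zero.2 (catalan_ne_zero n)), one_smul]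

theorem map_retraction_treeSeries : map retraction.toRingHom treeSeries = Hdif.genSeries := by
  have h : map retraction.toRingHom (mapCoeff V treeSeries) = Hdif.vSeries := by
    ext n
    simp [retraction_V_t]
  rw [← one_mul Hdif.genSeries]
  refine eq_mul_of_eq_add_mul_X_mul ?_ Hdif.genSeries_eq_one_add_mul
  rw [← h]
  exact map_treeSeries_eq_one_add_mul _

theorem retraction_comp_Ω : retraction.comp Ω = .id ℂ Hdif :=
  Hdif.hom_ext fun n => by
    simpa [Ω_a] using congrArg (coeff (n + 1)) map_retraction_treeSeries

theorem Ω_injective : Function.Injective Ω :=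
  Function.LeftInverse.injective (g := retraction) (AlgHom.congr_fun retraction_comp_Ω)

end NCDiff

end

theorem theorem4p1 :
    -- `Ω` is the homomorphism of unital algebras with `a_n ↦ t_n`
    (∀ n : ℕ, Ω (Hdif.a n) = Htree.t n) ∧
    -- `Ω` is injective
    Function.Injective Ω ∧
    -- `Ω` is a homomorphism of co-algebras
    (∀ x : Hdif, Coalgebra.counit (R := ℂ) (Ω x) = Coalgebra.counit (R := ℂ) x) ∧
    (∀ x : Hdif, Coalgebra.comul (R := ℂ) (Ω x) =
      TensorProduct.map Ω.toLinearMap Ω.toLinearMap (Coalgebra.comul (R := ℂ) x)) ∧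
    -- `Ω` identifies the Hopf algebra `Hdif` with a Hopf subalgebra of the tree Hopf algebra
    (∀ x : Hdif, HopfAlgebra.antipode ℂ (Ω x) = Ω (HopfAlgebra.antipode ℂ x)) ∧
    IsHopfSubalgebra Ω.range ∧
    -- the right co-action on `t_n`: `δ t_n = ∑_{k=0}^n t_k ⊗ Q^{(k-1)}_{n-k}(t)`
    (∀ n : ℕ, Htree.δ (Htree.t n) =
      ∑ k ∈ Finset.range (n + 1), Htree.t k ⊗ₜ[ℂ] Qpoly Htree.t k (n - k)) := by
  exact ⟨Ω_a, Ω_injective, CoalgHomClass.counit_comp_apply ΩBialgHom,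
    fun x => (CoalgHomClass.map_comp_comul_apply ΩBialgHom x).symm,
    antipode_bialgHom_apply ΩBialgHom, isHopfSubalgebra_range ΩBialgHom, δ_t⟩
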